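/- Let $k$ be a field of characteristic different from $2$, let $n\ge 1$, and let $A=(a_{ij})$ be the generic $n\times n$ matrix, whose entries are $n^2$ independent variables. Put $R=k[a_{ij}]$ and $S=k[d_{ij}]$, and let $S$ act on $R$ by contraction: $d^{u}\circ a^{v}=a^{v-u}$ if $u\le v$ componentwise and $d^{u}\circ a^{v}=0$ otherwise, for exponent vectors $u,v$, extended $k$-bilinearly. For $F\in R$ let $\mathrm{Ann}(F)=\{g\in S: g\circ F=0\}$. A zero-dimensional closed subscheme $\Gamma\subset\mathbf P(R_1)=\operatorname{Proj} S$, with saturated homogeneous ideal $I_\Gamma\subset S$, is called apolar to $F$ if $I_\Gamma\subset\mathrm{Ann}(F)$. Its degree $\deg\Gamma$ is the constant value of $\dim_k (S/I_\Gamma)_m$ for $m\gg 0$. Define the cactus rank, the smoothable rank and the rank of $F$ by $$cr(F)=\min\{\deg\Gamma:\ \Gamma \text{ apolar to } F\},$$ $$sr(F)=\min\{\deg\Gamma:\ \Gamma \text{ smoothable and apolar to } F\},$$ $$r(F)=\min\{\deg\Gamma:\ \Gamma \text{ smooth and apolar to } F\},$$ where $\Gamma$ ranges over zero-dimensional closed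 subschemes of $\mathbf P(R_1)$; smooth means that over the algebraic closure of $k$ the scheme $\Gamma$ is a set of distinct reduced points, and smoothable means that over the algebraic closure of $k$ it is a flat limit of sets of $\deg\Gamma$ distinct reduced points. If $F=\det(A)$ or $F=\mathrm{Per}(A)$, then these minima exist and $$\frac12\binom{2n}{n}\ \le\ cr(F)\ \le\ sr(F)\ \le\ r(F).$$ -/

import Mathlib

open MvPolynomial Filter

namespace Apolarity

noncomputable section

attribute [local instance] MvPolynomial.gradedAlgebra

/-- Contraction by monomials, as a monoid homomorphism: the monomial with exponent vector `u`
sends the monomial with exponent vector `v` to the one with exponent `v - u` if `u ≤ v`,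
and to `0` otherwise. -/
def monomialContraction (k σ : Type*) [Field k] :
    Multiplicative (σ →₀ ℕ) →* Module.End k (MvPolynomial σ k) where
  toFun u :=
    { toFun := fun F => F.divMonomial u.toAdd
      map_add' := fun F G => add_divMonomial F G u.toAdd
      map_smul' := fun c F => by
        ext v
        simp [coeff_divMonomial] }
  map_one' := by
    ext F v
    simp [coeff_divMonomial]
  map_mul' u v := by
    ext F w
    simp [coeff_divMonomial, add_assoc, add_left_comm]

/-- The contraction action `g ∘ F` of `S = k[d_i]` on `R = k[a_i]`, written
`contraction k σ g F`: it is the bilinear extension of the contraction by monomials.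
(Both polynomial rings are modelled by `MvPolynomial σ k`.) -/
def contraction (k σ : Type*) [Field k] :
    MvPolynomial σ k →ₐ[k] Module.End k (MvPolynomial σ k) :=
  AddMonoidAlgebra.lift k (Module.End k (MvPolynomial σ k)) (σ →₀ ℕ) (monomialContraction k σ)

/-- The apolar ideal `Ann(F) = {g ∈ S | g ∘ F = 0}`. -/
def apolarIdeal {k σ : Type*} [Field k] (F : MvPolynomial σ k) : Ideal (MvPolynomial σ k) where
  carrier := {g | contraction k σ g F = 0}
  add_mem' := fun {a b} ha hb => by
    simp only [Set.mem_ofPred_eq] at ha hb ⊢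
    rw [map_add, LinearMap.add_apply, ha, hb, add_zero]
  zero_mem' := by simp
  smul_mem' := fun a b hb => by
    simp only [Set.mem_ofPred_eq] at hb ⊢
    rw [smul_eq_mul, map_mul, Module.End.mul_apply, hb, map_zero]

/-- The Hilbert function `m ↦ dim_k (S/I)_m = dim_k S_m / (I ∩ S_m)`. -/
def hilbertFunction {k σ : Type*} [Field k] (I : Ideal (MvPolynomial σ k)) (m : ℕ) : ℕ :=
  Module.finrank k (homogeneousSubmodule σ k m ⧸
    (I.restrictScalars k).comap (homogeneousSubmodule σ k m).subtype)

/-- A closed subscheme `Γ` of dimension zero of the projective space with homogeneous coordinate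
ring `S = k[d_i]`, given by its saturated homogeneous ideal `I_Γ`.  Dimension zero and degree `s`
mean that the Hilbert polynomial of `S / I_Γ` is the nonzero constant `s`. -/
structure ZeroDimSubscheme (k σ : Type*) [Field k] where
  /-- the homogeneous ideal `I_Γ` -/
  ideal : Ideal (MvPolynomial σ k)
  homogeneous : ideal.IsHomogeneous (homogeneousSubmodule σ k)
  saturated : ∀ f, (∀ i, ∃ e : ℕ, X i ^ e * f ∈ ideal) → f ∈ ideal
  /-- the degree (length) of `Γ` -/
  degree : ℕ
  degree_pos : 0 < degree
  hilbert_eventually : ∀ᶠ m in atTop, hilbertFunction ideal m = degree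

/-- The extension of the ideal of `Γ` to the algebraic closure of the base field, that is, the
ideal of the base change of `Γ`. -/
def ZeroDimSubscheme.geomIdeal {k σ : Type*} [Field k] (Γ : ZeroDimSubscheme k σ) :
    Ideal (MvPolynomial σ (AlgebraicClosure k)) :=
  Γ.ideal.map (MvPolynomial.map (algebraMap k (AlgebraicClosure k)))

/-- A zero-dimensional scheme over a field is smooth iff it is geometrically reduced: over the
algebraic closure it is a set of distinct simple points. -/
def ZeroDimSubscheme.IsSmooth {k σ : Type*} [Field k] (Γ : ZeroDimSubscheme k σ) : Prop :=
  Γ.geomIdeal.IsRadical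

/-- `g` is the value at `t = 0` of a form `f` of degree `m` over `K⟦t⟧` that vanishes at the
points `p j`, which are points of projective space over `K((t))`. For fixed `m`, such `g` form
the degree-`m` part of the limit, as `t → 0`, of the ideals of the point sets `{p j}`. -/
def IsLimitForm {K σ : Type*} [Field K] {s : ℕ}
    (p : Fin s → Projectivization (LaurentSeries K) (σ → LaurentSeries K))
    (m : ℕ) (g : MvPolynomial σ K) : Prop :=
  ∃ f : MvPolynomial σ (PowerSeries K), f.IsHomogeneous m ∧
    (∀ j, aeval (p j).rep f = 0) ∧ MvPolynomial.map PowerSeries.constantCoeff f = g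

/-- `Γ`, of degree `s`, is smoothable: over the algebraic closure `K` of the base field it is
the limit (flat limit, as `t → 0`) of a one-parameter family of `s` distinct simple points.
Two closed subschemes of projective space are equal iff their ideals agree in all large
degrees. -/
def ZeroDimSubscheme.IsSmoothable {k σ : Type*} [Field k] (Γ : ZeroDimSubscheme k σ) : Prop :=
  ∃ p : Fin Γ.degree → Projectivization (LaurentSeries (AlgebraicClosure k))
      (σ → LaurentSeries (AlgebraicClosure k)),
    Function.Injective p ∧
    ∀ᶠ m in atTop, ∀ g : MvPolynomial σ (AlgebraicClosure k), g.IsHomogeneous m →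
      (g ∈ Γ.geomIdeal ↔ IsLimitForm p m g)

/-- `Γ` is apolar to `F`: `I_Γ ⊆ Ann(F)`. -/
def ZeroDimSubscheme.IsApolar {k σ : Type*} [Field k] (Γ : ZeroDimSubscheme k σ)
    (F : MvPolynomial σ k) : Prop :=
  Γ.ideal ≤ apolarIdeal F

/-- The cactus rank `cr(F)`. (As for the other ranks, the value would be `0` if there were no
such `Γ`; a positive value is an attained minimum.) -/
def cactusRank {k σ : Type*} [Field k] (F : MvPolynomial σ k) : ℕ :=
  sInf {s | ∃ Γ : ZeroDimSubscheme k σ, Γ.IsApolar F ∧ Γ.degree = s}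

/-- The smoothable rank `sr(F)`. -/
def smoothableRank {k σ : Type*} [Field k] (F : MvPolynomial σ k) : ℕ :=
  sInf {s | ∃ Γ : ZeroDimSubscheme k σ, Γ.IsSmoothable ∧ Γ.IsApolar F ∧ Γ.degree = s}

/-- The rank `r(F)`. -/
def rank {k σ : Type*} [Field k] (F : MvPolynomial σ k) : ℕ :=
  sInf {s | ∃ Γ : ZeroDimSubscheme k σ, Γ.IsSmooth ∧ Γ.IsApolar F ∧ Γ.degree = s}

end

end Apolarity

namespace Apolarity

/-! ### Hilbert functions computed from explicit forms -/

section HilbertFunction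

variable {k σ : Type*} [Field k]

/-! Lower bound. The monomials of `F` are squarefree, so $\mathrm{Ann}(F)$ contains all $d_{ij}^2$.
Over an infinite field, some linear combination $q$ of these squares is a nonzerodivisor modulo a
saturated ideal $J$ (`exists_quadric_regular`). If $J\subset\mathrm{Ann}(F)$ has constant Hilbert
polynomial $s$, then $S/(J+(q))$ has length $2s$ and surjects onto $S/\mathrm{Ann}(F)$, whose length
is therefore at most $2s$ (`sum_hilbertFunction_le`). In degree $m$, the choices of $m$ rows and $m$
columns give $\binom nm^2$ independent classes (`IsPermutationForm.choose_sq_le`), and $\sum_m\binom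
nm^2=\binom{2n}n$. Extension to the algebraic closure, which preserves Hilbert functions, saturation
and apolarity, supplies the infinite field.

Comparison of ranks. A smooth scheme is geometrically a set of points (Nullstellensatz), hence the
limit of a constant family. The minima exist because, by polarization in characteristic different
from 2, the points with coordinates $0,\pm1$ are apolar to every squarefree polynomial
(`exists_isSmooth_isApolar`). -/

theorem card_le_hilbertFunction [Finite σ] {ι : Type*} [Fintype ι] (I : Ideal (MvPolynomial σ k))
    (m : ℕ) (w : ι → MvPolynomial σ k) (hw : ∀ i, (w i).IsHomogeneous m)
    (hli : ∀ c : ι → k, ∑ i, C (c i) * w i ∈ I → ∀ i, c i = 0) :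
    Fintype.card ι ≤ hilbertFunction I m := by
  have : Module.Finite k (homogeneousSubmodule σ k m) :=
    Module.Finite.iff_fg.2 (homogeneousSubmodule_fg σ k m)
  let q := ((I.restrictScalars k).comap (homogeneousSubmodule σ k m).subtype).mkQ
  have hind : LinearIndependent k
      (fun i => q ⟨w i, (mem_homogeneousSubmodule _ _).2 (hw i)⟩) := by
    rw [Fintype.linearIndependent_iff]
    intro c hc
    apply hli
    simp_rw [← map_smul, ← map_sum] at hc
    rw [Submodule.mkQ_apply, Submodule.Quotient.mk_eq_zero] at hc
    simpa [smul_eq_C_mul] using hc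
  exact hind.fintype_card_le_finrank

theorem hilbertFunction_eq_card {ι : Type*} [Fintype ι] (I : Ideal (MvPolynomial σ k))
    (m : ℕ) (w : ι → MvPolynomial σ k) (hw : ∀ i, (w i).IsHomogeneous m)
    (hli : ∀ c : ι → k, ∑ i, C (c i) * w i ∈ I → ∀ i, c i = 0)
    (hspan : ∀ f : MvPolynomial σ k, f.IsHomogeneous m → ∃ c : ι → k, f - ∑ i, C (c i) * w i ∈ I) :
    hilbertFunction I m = Fintype.card ι := by
  let q := ((I.restrictScalars k).comap (homogeneousSubmodule σ k m).subtype).mkQ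
  have hind : LinearIndependent k
      (fun i => q ⟨w i, (mem_homogeneousSubmodule _ _).2 (hw i)⟩) := by
    rw [Fintype.linearIndependent_iff]
    intro c hc
    apply hli
    simp_rw [← map_smul, ← map_sum] at hc
    rw [Submodule.mkQ_apply, Submodule.Quotient.mk_eq_zero] at hc
    simpa [smul_eq_C_mul] using hc
  have hsp : ⊤ ≤ Submodule.span k
      (Set.range fun i => q ⟨w i, (mem_homogeneousSubmodule _ _).2 (hw i)⟩) := by
    intro x _
    obtain ⟨⟨f, hf⟩, rfl⟩ := Submodule.mkQ_surjective _ x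
    obtain ⟨c, hc⟩ := hspan f ((mem_homogeneousSubmodule _ _).1 hf)
    rw [Submodule.mem_span_range_iff_exists_fun]
    refine ⟨c, ?_⟩
    simp_rw [← map_smul, ← map_sum]
    symm
    rw [Submodule.mkQ_apply, Submodule.mkQ_apply, Submodule.Quotient.eq]
    simpa [smul_eq_C_mul] using hc
  exact Module.finrank_eq_card_basis (Module.Basis.mk hind hsp)

/-- Lifts of a basis of $(S/I)_m$. With them, comparing dimensions for different ideals or different
fields reduces to manipulating forms. -/
theorem exists_forms_of_hilbertFunction [Finite σ] (I : Ideal (MvPolynomial σ k)) (m : ℕ) :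
    ∃ w : Fin (hilbertFunction I m) → MvPolynomial σ k, (∀ i, (w i).IsHomogeneous m) ∧
      (∀ c : Fin (hilbertFunction I m) → k, ∑ i, C (c i) * w i ∈ I → ∀ i, c i = 0) ∧
      ∀ f : MvPolynomial σ k, f.IsHomogeneous m →
        ∃ c : Fin (hilbertFunction I m) → k, f - ∑ i, C (c i) * w i ∈ I := by
  have : Module.Finite k (homogeneousSubmodule σ k m) :=
    Module.Finite.iff_fg.2 (homogeneousSubmodule_fg σ k m)
  let N := (I.restrictScalars k).comap (homogeneousSubmodule σ k m).subtype
  let b : Module.Basis (Fin (hilbertFunction I m)) k (homogeneousSubmodule σ k m ⧸ N) :=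
    Module.finBasis k _
  choose w hw using fun i => N.mkQ_surjective (b i)
  refine ⟨fun i => w i, fun i => (mem_homogeneousSubmodule _ _).1 (w i).2, ?_, ?_⟩
  · intro c hc
    have h0 : N.mkQ (∑ i, c i • w i) = 0 := by
      rw [Submodule.mkQ_apply, Submodule.Quotient.mk_eq_zero]
      simpa [N, smul_eq_C_mul] using hc
    simp_rw [map_sum, map_smul, hw] at h0
    exact Fintype.linearIndependent_iff.1 b.linearIndependent c h0
  · intro f hf
    let F : homogeneousSubmodule σ k m := ⟨f, (mem_homogeneousSubmodule _ _).2 hf⟩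
    refine ⟨b.repr (N.mkQ F), ?_⟩
    have h0 : N.mkQ F = N.mkQ (∑ i, b.repr (N.mkQ F) i • w i) := by
      simp_rw [map_sum, map_smul, hw]
      exact (b.sum_repr _).symm
    rw [Submodule.mkQ_apply, Submodule.mkQ_apply, Submodule.Quotient.eq] at h0
    simpa [N, F, smul_eq_C_mul] using h0

end HilbertFunction

/-! ### Extension of the base field -/

section BaseChange

variable {k K σ : Type*} [Field k] [Field K] [Algebra k K]

/-- A `k`-linear functional on the field extension `K`, applied to all coefficients. -/
noncomputable def coeffwise (φ : K →ₗ[k] k) : MvPolynomial σ K →+ MvPolynomial σ k where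
  toFun f := ∑ u ∈ f.support, monomial u (φ (coeff u f))
  map_zero' := by simp
  map_add' f g := by
    have h : ∀ (p : MvPolynomial σ K) (v : σ →₀ ℕ),
        coeff v (∑ u ∈ p.support, monomial u (φ (coeff u p))) = φ (coeff v p) := by
      classical
      intro p v
      simp +contextual [coeff_sum, coeff_monomial]
    ext v
    rw [coeff_add, h, h, h, coeff_add, map_add]

@[simp]
theorem coeff_coeffwise (φ : K →ₗ[k] k) (f : MvPolynomial σ K) (v : σ →₀ ℕ) :
    coeff v (coeffwise φ f) = φ (coeff v f) := by
  classical
  simp +contextual [coeffwise, coeff_sum, coeff_monomial]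

theorem coeffwise_C_mul_map (φ : K →ₗ[k] k) (c : K) (f : MvPolynomial σ k) :
    coeffwise φ (C c * MvPolynomial.map (algebraMap k K) f) = C (φ c) * f := by
  ext v
  rw [coeff_coeffwise, coeff_C_mul, coeff_C_mul, coeff_map, mul_comm c, ← Algebra.smul_def,
    map_smul, smul_eq_mul, mul_comm]

/-- A scalar from `K` is absorbed into the functional. Hence the condition "all functionals send `f`
into `I`" defines an ideal over `K`, although a single `φ` need not. -/
theorem coeffwise_monomial_mul (φ : K →ₗ[k] k) (u : σ →₀ ℕ) (c : K) (f : MvPolynomial σ K) :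
    coeffwise φ (monomial u c * f) =
      monomial u 1 * coeffwise (φ ∘ₗ LinearMap.mulLeft k c) f := by
  classical
  ext v
  simp only [coeff_coeffwise, coeff_monomial_mul', one_mul]
  split_ifs <;> simp

theorem coeffwise_isHomogeneous (φ : K →ₗ[k] k) {f : MvPolynomial σ K} {m : ℕ}
    (hf : f.IsHomogeneous m) : (coeffwise φ f).IsHomogeneous m := by
  intro v hv
  apply hf
  intro h
  simp [h] at hv

theorem coeffwise_homogeneousComponent (φ : K →ₗ[k] k) (f : MvPolynomial σ K) (m : ℕ) :
    coeffwise φ (homogeneousComponent m f) = homogeneousComponent m (coeffwise φ f) := by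
  ext v
  simp only [coeff_coeffwise, coeff_homogeneousComponent]
  split_ifs <;> simp

theorem eval_coeffwise (φ : K →ₗ[k] k) (f : MvPolynomial σ K) (z : σ → k) :
    eval z (coeffwise φ f) = φ (eval (fun i => algebraMap k K (z i)) f) := by
  induction f using MvPolynomial.induction_on' with
  | monomial u c =>
    have h : coeffwise φ (monomial u c) = monomial u (φ c) := by
      classical
      ext v
      simp only [coeff_coeffwise, coeff_monomial]
      split_ifs <;> simp
    rw [h, eval_monomial, eval_monomial]
    simp only [Finsupp.prod, ← map_pow, ← map_prod]
    rw [mul_comm c, ← Algebra.smul_def, map_smul, smul_eq_mul, mul_comm]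
  | add p q hp hq => simp [hp, hq]

theorem exists_eq_sum_C_mul_map (f : MvPolynomial σ K) :
    ∃ (s : Finset (Module.Free.ChooseBasisIndex k K)), f = ∑ β ∈ s,
      C (Module.Free.chooseBasis k K β) *
        MvPolynomial.map (algebraMap k K) (coeffwise ((Module.Free.chooseBasis k K).coord β) f) := by
  classical
  let b := Module.Free.chooseBasis k K
  refine ⟨f.support.biUnion fun u => (b.repr (coeff u f)).support, ?_⟩
  ext v
  simp only [coeff_sum, coeff_C_mul, coeff_map, coeff_coeffwise, Module.Basis.coord_apply]
  have h := b.linearCombination_repr (coeff v f)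
  rw [Finsupp.linearCombination_apply] at h
  conv_lhs => rw [← h]
  by_cases hv : v ∈ f.support
  · rw [Finsupp.sum_of_support_subset _ (s := f.support.biUnion fun u =>
      (b.repr (coeff u f)).support)]
    · refine Finset.sum_congr rfl fun β _ => ?_
      rw [Algebra.smul_def, mul_comm]
    · exact Finset.subset_biUnion_of_mem (fun u => (b.repr (coeff u f)).support) hv
    · simp
  · rw [notMem_support_iff.1 hv]
    simp

/-- Membership in the extension of an ideal along a field extension is tested on coordinates. -/
theorem mem_map_iff_coeffwise_mem (I : Ideal (MvPolynomial σ k)) (f : MvPolynomial σ K) :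
    f ∈ I.map (MvPolynomial.map (algebraMap k K)) ↔ ∀ φ : K →ₗ[k] k, coeffwise φ f ∈ I := by
  constructor
  · intro hf
    refine Submodule.span_induction (p := fun f _ => ∀ φ : K →ₗ[k] k, coeffwise φ f ∈ I)
      ?_ ?_ ?_ ?_ hf
    · rintro _ ⟨g, hg, rfl⟩ φ
      have := coeffwise_C_mul_map φ 1 g
      rw [C_1, one_mul] at this
      rw [this]
      exact I.mul_mem_left _ hg
    · simp
    · intro x y _ _ hx hy φ
      rw [map_add]
      exact I.add_mem (hx φ) (hy φ)
    · intro a x _ hx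
      induction a using MvPolynomial.induction_on' with
      | monomial u c =>
        intro φ
        rw [smul_eq_mul, coeffwise_monomial_mul]
        exact I.mul_mem_left _ (hx _)
      | add p q hp hq =>
        intro φ
        rw [add_smul, map_add]
        exact I.add_mem (hp φ) (hq φ)
  · intro hf
    obtain ⟨s, hs⟩ := exists_eq_sum_C_mul_map (k := k) f
    rw [hs]
    exact Ideal.sum_mem _ fun β _ => Ideal.mul_mem_left _ _ (Ideal.mem_map_of_mem _ (hf _))

/-- Forms that are a basis modulo `I` remain one over `K`: independence is tested by functionals,
spanning by expanding coefficients in a `k`-basis of `K`. -/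
theorem hilbertFunction_map [Finite σ] (I : Ideal (MvPolynomial σ k)) (m : ℕ) :
    hilbertFunction (I.map (MvPolynomial.map (algebraMap k K))) m = hilbertFunction I m := by
  obtain ⟨w, hw, hli, hspan⟩ := exists_forms_of_hilbertFunction I m
  rw [hilbertFunction_eq_card (I.map (MvPolynomial.map (algebraMap k K))) m
    (fun i => MvPolynomial.map (algebraMap k K) (w i)) (fun i => (hw i).map _), Fintype.card_fin]
  · intro c hc i
    rw [mem_map_iff_coeffwise_mem] at hc
    rw [← Module.forall_dual_apply_eq_zero_iff k]
    intro φ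
    have := hc φ
    simp_rw [map_sum, coeffwise_C_mul_map] at this
    exact hli _ this i
  · intro f hf
    obtain ⟨s, hs⟩ := exists_eq_sum_C_mul_map (k := k) f
    choose c hc using fun β => hspan _
      (coeffwise_isHomogeneous ((Module.Free.chooseBasis k K).coord β) hf)
    refine ⟨fun i => ∑ β ∈ s, Module.Free.chooseBasis k K β * algebraMap k K (c β i), ?_⟩
    have : f - ∑ i, C (∑ β ∈ s, Module.Free.chooseBasis k K β * algebraMap k K (c β i)) *
        MvPolynomial.map (algebraMap k K) (w i) = ∑ β ∈ s, C (Module.Free.chooseBasis k K β) *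
          MvPolynomial.map (algebraMap k K) (coeffwise ((Module.Free.chooseBasis k K).coord β) f -
            ∑ i, C (c β i) * w i) := by
      simp only [map_sub, mul_sub, Finset.sum_sub_distrib, ← hs, map_sum, map_mul, map_C,
        Finset.sum_mul, Finset.mul_sum]
      rw [Finset.sum_comm]
      simp only [mul_assoc]
    rw [this]
    exact Ideal.sum_mem _ fun β _ => Ideal.mul_mem_left _ _ (Ideal.mem_map_of_mem _ (hc β))

theorem homogeneousComponent_mem_map {I : Ideal (MvPolynomial σ k)}
    (hI : ∀ f ∈ I, ∀ m, homogeneousComponent m f ∈ I) (f : MvPolynomial σ K)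
    (hf : f ∈ I.map (MvPolynomial.map (algebraMap k K))) (m : ℕ) :
    homogeneousComponent m f ∈ I.map (MvPolynomial.map (algebraMap k K)) := by
  rw [mem_map_iff_coeffwise_mem] at hf ⊢
  intro φ
  rw [coeffwise_homogeneousComponent]
  exact hI _ (hf φ) m

theorem mem_map_of_X_pow_mul_mem {I : Ideal (MvPolynomial σ k)}
    (hI : ∀ f, (∀ i, ∃ e : ℕ, X i ^ e * f ∈ I) → f ∈ I) (f : MvPolynomial σ K)
    (hf : ∀ i, ∃ e : ℕ, X i ^ e * f ∈ I.map (MvPolynomial.map (algebraMap k K))) :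
    f ∈ I.map (MvPolynomial.map (algebraMap k K)) := by
  rw [mem_map_iff_coeffwise_mem]
  intro φ
  refine hI _ fun i => ?_
  obtain ⟨e, he⟩ := hf i
  refine ⟨e, ?_⟩
  have := (mem_map_iff_coeffwise_mem I _).1 he φ
  rw [X_pow_eq_monomial] at this ⊢
  rw [coeffwise_monomial_mul] at this
  simpa using this

end BaseChange

/-! ### Finite sets of points, and smooth implies smoothable -/

theorem aeval_smul_of_isHomogeneous {R A σ : Type*} [CommRing R] [CommRing A] [Algebra R A]
    {f : MvPolynomial σ R} {m : ℕ} (hf : f.IsHomogeneous m) (c : A) (v : σ → A) :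
    aeval (c • v) f = c ^ m * aeval v f := by
  rw [aeval_def, aeval_def, eval₂_eq, eval₂_eq, Finset.mul_sum]
  refine Finset.sum_congr rfl fun d hd => ?_
  have hdeg : ∑ i ∈ d.support, d i = m := by
    rw [← Finsupp.degree_apply]
    by_contra h
    exact (mem_support_iff.1 hd) (hf.coeff_eq_zero h)
  simp only [Pi.smul_apply, smul_eq_mul, mul_pow, Finset.prod_mul_distrib,
    Finset.prod_pow_eq_pow_sum, hdeg]
  ring

section Points

variable {K σ : Type*} [Field K]

theorem eval_smul_of_isHomogeneous {f : MvPolynomial σ K} {m : ℕ} (hf : f.IsHomogeneous m)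
    (c : K) (v : σ → K) : eval (c • v) f = c ^ m * eval v f := by
  have := aeval_smul_of_isHomogeneous hf c v
  simpa only [aeval_eq_eval] using this

theorem eval_rep_mk_eq_zero_iff {f : MvPolynomial σ K} {m : ℕ} (hf : f.IsHomogeneous m)
    (v : σ → K) (hv : v ≠ 0) :
    eval (Projectivization.mk K v hv).rep f = 0 ↔ eval v f = 0 := by
  obtain ⟨a, ha⟩ := Projectivization.exists_smul_eq_mk_rep K v hv
  rw [← ha, Units.smul_def, eval_smul_of_isHomogeneous hf]
  simp

/-- If all $2\times2$ minors of the two coordinate vectors vanished, the vectors would be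
proportional. -/
theorem exists_mul_rep_ne_mul_rep {p q : Projectivization K (σ → K)} (h : p ≠ q) :
    ∃ a b, p.rep a * q.rep b ≠ p.rep b * q.rep a := by
  by_contra! H
  apply h
  obtain ⟨a, ha⟩ := Function.ne_iff.1 q.rep_nonzero
  rw [← p.mk_rep, ← q.mk_rep, Projectivization.mk_eq_mk_iff']
  refine ⟨p.rep a / q.rep a, ?_⟩
  ext b
  have := H a b
  simp only [Pi.zero_apply] at ha
  simp only [Pi.smul_apply, smul_eq_mul]
  field_simp
  rw [this, mul_comm]

theorem exists_linearForm_separating {p q : Projectivization K (σ → K)} (h : p ≠ q) :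
    ∃ l : MvPolynomial σ K, l.IsHomogeneous 1 ∧ eval p.rep l = 0 ∧ eval q.rep l ≠ 0 := by
  obtain ⟨a, b, hab⟩ := exists_mul_rep_ne_mul_rep h
  refine ⟨C (p.rep a) * X b - C (p.rep b) * X a,
    (isHomogeneous_C_mul_X _ _).sub (isHomogeneous_C_mul_X _ _), ?_, ?_⟩
  · simp [mul_comm]
  · simpa [sub_eq_zero] using hab

/-- In all large degrees there are forms dual to a given finite set of points. -/
theorem exists_dual_forms {ι : Type*} [Fintype ι] [DecidableEq ι]
    (p : ι → Projectivization K (σ → K)) (hp : Function.Injective p) (m : ℕ)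
    (hm : Fintype.card ι ≤ m) :
    ∃ w : ι → MvPolynomial σ K, (∀ j, (w j).IsHomogeneous m) ∧
      ∀ i j, eval (p i).rep (w j) = if i = j then 1 else 0 := by
  have key : ∀ j, ∃ w : MvPolynomial σ K, w.IsHomogeneous m ∧
      ∀ i, eval (p i).rep w = if i = j then 1 else 0 := by
    intro j
    have hl : ∀ i, ∃ l : MvPolynomial σ K, l.IsHomogeneous 1 ∧
        (i ≠ j → eval (p i).rep l = 0) ∧ eval (p j).rep l ≠ 0 := by
      intro i
      by_cases hij : i = j
      · obtain ⟨a, ha⟩ := Function.ne_iff.1 (p j).rep_nonzero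
        exact ⟨X a, isHomogeneous_X _ _, fun h => absurd hij h, by simpa using ha⟩
      · obtain ⟨l, h1, h2, h3⟩ := exists_linearForm_separating (hp.ne hij)
        exact ⟨l, h1, fun _ => h2, h3⟩
    choose l h1 h2 h3 using hl
    -- The factors with `i ≠ j` kill the other points, `l j` is a coordinate nonzero at `p j`, and
    -- its extra power fills the degree up to `m`.
    have hh : (l j ^ (m - Fintype.card ι) * ∏ i, l i).IsHomogeneous m := by
      have := ((h1 j).pow (m - Fintype.card ι)).mul
        (IsHomogeneous.prod Finset.univ l (fun _ => 1) fun i _ => h1 i)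
      simpa [Nat.sub_add_cancel hm] using this
    have hne : eval (p j).rep (l j ^ (m - Fintype.card ι) * ∏ i, l i) ≠ 0 := by
      rw [map_mul, map_pow, map_prod]
      exact mul_ne_zero (pow_ne_zero _ (h3 j)) (Finset.prod_ne_zero_iff.2 fun i _ => h3 i)
    refine ⟨C (eval (p j).rep (l j ^ (m - Fintype.card ι) * ∏ i, l i))⁻¹ *
      (l j ^ (m - Fintype.card ι) * ∏ i, l i), hh.C_mul _, fun i => ?_⟩
    split_ifs with hij
    · subst hij
      rw [map_mul, eval_C, inv_mul_cancel₀ hne]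
    · have : eval (p i).rep (∏ i, l i) = 0 := by
        rw [map_prod]
        exact Finset.prod_eq_zero (Finset.mem_univ i) (h2 i hij)
      rw [map_mul, map_mul (eval (p i).rep) (l j ^ _), this, mul_zero, mul_zero]
  choose w h1 h2 using key
  exact ⟨w, h1, fun i j => h2 j i⟩

theorem card_points_le_hilbertFunction [Finite σ] {ι : Type*} [Fintype ι]
    (p : ι → Projectivization K (σ → K)) (hp : Function.Injective p) (m : ℕ)
    (hm : Fintype.card ι ≤ m) (I : Ideal (MvPolynomial σ K))
    (hI : ∀ f ∈ I, f.IsHomogeneous m → ∀ j, eval (p j).rep f = 0) :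
    Fintype.card ι ≤ hilbertFunction I m := by
  classical
  obtain ⟨w, hw, hd⟩ := exists_dual_forms p hp m hm
  refine card_le_hilbertFunction I m w hw fun c hc i => ?_
  have := hI _ hc (IsHomogeneous.sum _ _ _ fun j _ => (hw j).C_mul _) i
  simpa [hd] using this

theorem hilbertFunction_eq_card_points {ι : Type*} [Fintype ι]
    (p : ι → Projectivization K (σ → K)) (hp : Function.Injective p) (m : ℕ)
    (hm : Fintype.card ι ≤ m) (I : Ideal (MvPolynomial σ K))
    (hI : ∀ f, f.IsHomogeneous m → (f ∈ I ↔ ∀ j, eval (p j).rep f = 0)) :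
    hilbertFunction I m = Fintype.card ι := by
  classical
  obtain ⟨w, hw, hd⟩ := exists_dual_forms p hp m hm
  have hh : ∀ c : ι → K, (∑ i, C (c i) * w i).IsHomogeneous m :=
    fun c => IsHomogeneous.sum _ _ _ fun j _ => (hw j).C_mul _
  refine hilbertFunction_eq_card I m w hw (fun c hc i => ?_) fun f hf => ?_
  · have := (hI _ (hh c)).1 hc i
    simpa [hd] using this
  · refine ⟨fun i => eval (p i).rep f, ?_⟩
    rw [hI _ (hf.sub (hh _))]
    intro j
    simp [hd]

/-- The homogeneous ideal of a set of points in projective space. -/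
noncomputable def pointsIdeal {ι : Type*} (p : ι → Projectivization K (σ → K)) :
    Ideal (MvPolynomial σ K) :=
  ⨅ j, RingHom.ker (aeval (R := K) fun i => Polynomial.C ((p j).rep i) * Polynomial.X)

/-- Restriction to the line through `z` reads $f(zt)=\sum_m f_m(z)t^m$. So the kernels defining
`pointsIdeal` are homogeneous, and they are prime since $K[t]$ is a domain. -/
theorem coeff_aeval_C_mul_X (f : MvPolynomial σ K) (z : σ → K) (m : ℕ) :
    (aeval (fun i => Polynomial.C (z i) * Polynomial.X) f).coeff m =
      eval z (homogeneousComponent m f) := by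
  induction f using MvPolynomial.induction_on' with
  | monomial u c =>
    have h : aeval (fun i => Polynomial.C (z i) * Polynomial.X) (monomial u c) =
        Polynomial.monomial u.degree (eval z (monomial u c)) := by
      rw [aeval_monomial, eval_monomial, ← Polynomial.C_mul_X_pow_eq_monomial, Finsupp.degree_apply]
      simp only [Finsupp.prod, mul_pow, Finset.prod_mul_distrib, Finset.prod_pow_eq_pow_sum,
        map_mul, map_prod, map_pow, mul_assoc]
      rfl
    rw [h, Polynomial.coeff_monomial]
    split_ifs with hm
    · rw [homogeneousComponent_of_mem ((mem_homogeneousSubmodule _ _).2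
        (isHomogeneous_monomial c hm)), if_pos rfl]
    · rw [homogeneousComponent_of_mem ((mem_homogeneousSubmodule _ _).2
        (isHomogeneous_monomial c rfl)), if_neg (Ne.symm hm), map_zero]
  | add p q hp hq => simp [hp, hq]

theorem mem_pointsIdeal {ι : Type*} {p : ι → Projectivization K (σ → K)} {f : MvPolynomial σ K} :
    f ∈ pointsIdeal p ↔ ∀ j m, eval (p j).rep (homogeneousComponent m f) = 0 := by
  simp only [pointsIdeal, Ideal.mem_iInf, RingHom.mem_ker, Polynomial.ext_iff,
    coeff_aeval_C_mul_X, Polynomial.coeff_zero]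

theorem mem_pointsIdeal_of_isHomogeneous {ι : Type*} {p : ι → Projectivization K (σ → K)}
    {f : MvPolynomial σ K} {m : ℕ} (hf : f.IsHomogeneous m) :
    f ∈ pointsIdeal p ↔ ∀ j, eval (p j).rep f = 0 := by
  rw [mem_pointsIdeal]
  refine forall_congr' fun j => ⟨fun h => ?_, fun h i => ?_⟩
  · have := h m
    rwa [homogeneousComponent_of_mem ((mem_homogeneousSubmodule _ _).2 hf), if_pos rfl] at this
  · rw [homogeneousComponent_of_mem ((mem_homogeneousSubmodule _ _).2 hf)]
    split_ifs <;> simp [h]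

theorem pointsIdeal_isRadical {ι : Type*} (p : ι → Projectivization K (σ → K)) :
    (pointsIdeal p).IsRadical := by
  refine Ideal.isRadical_iInf _ fun j => ?_
  exact (RingHom.ker_isPrime _).isRadical

theorem homogeneousComponent_mem_pointsIdeal {ι : Type*} {p : ι → Projectivization K (σ → K)}
    {f : MvPolynomial σ K} (hf : f ∈ pointsIdeal p) (m : ℕ) :
    homogeneousComponent m f ∈ pointsIdeal p := by
  rw [mem_pointsIdeal_of_isHomogeneous (homogeneousComponent_isHomogeneous m f)]
  exact fun j => mem_pointsIdeal.1 hf j m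

/-- Over an algebraically closed field, a homogeneous radical ideal whose Hilbert polynomial is the
constant `s` is, in large degrees, the ideal of a set of `s` points. -/
theorem exists_points_of_isRadical [Finite σ] [IsAlgClosed K] {J : Ideal (MvPolynomial σ K)}
    (hrad : J.IsRadical) (hhom : ∀ f ∈ J, ∀ m, homogeneousComponent m f ∈ J) {s : ℕ}
    (hs : ∀ᶠ m in atTop, hilbertFunction J m = s) :
    ∃ p : Fin s → Projectivization K (σ → K), Function.Injective p ∧
      ∀ᶠ m in atTop, ∀ g : MvPolynomial σ K, g.IsHomogeneous m →
        (g ∈ J ↔ ∀ j, eval (p j).rep g = 0) := by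
  let Z : Set (Projectivization K (σ → K)) := {z | ∀ f ∈ J, eval z.rep f = 0}
  obtain ⟨M, hM⟩ := eventually_atTop.1 hs
  -- Distinct points impose independent conditions on forms of large degree, so `Z` has at most `s`
  -- points.
  have hcard : ∀ T : Finset (Projectivization K (σ → K)), (T : Set _) ⊆ Z → T.card ≤ s := by
    intro T hT
    have := card_points_le_hilbertFunction (fun t : T => (t : Projectivization K (σ → K)))
      Subtype.val_injective (max M T.card) (by simp) J fun f hf _ j => hT j.2 f hf
    rwa [hM _ (le_max_left _ _), Fintype.card_coe] at this
  have hfin : Z.Finite := by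
    by_contra h
    obtain ⟨T, hT, hTc⟩ := Set.Infinite.exists_subset_card_eq h (s + 1)
    have := hcard T hT
    omega
  -- Nullstellensatz on the affine cone over `Z`; positive degree takes care of the origin.
  have hmem : ∀ (m : ℕ), 1 ≤ m → ∀ g : MvPolynomial σ K, g.IsHomogeneous m →
      (g ∈ J ↔ ∀ z ∈ Z, eval z.rep g = 0) := by
    intro m hm g hg
    refine ⟨fun h z hz => hz g h, fun h => ?_⟩
    rw [← hrad.radical, ← vanishingIdeal_zeroLocus_eq_radical (K := K), mem_vanishingIdeal_iff]
    intro x hx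
    rw [mem_zeroLocus_iff] at hx
    simp only [aeval_eq_eval] at hx ⊢
    by_cases hx0 : x = 0
    · have := eval_smul_of_isHomogeneous hg 0 x
      rwa [zero_smul, zero_pow (by omega), zero_mul, ← hx0] at this
    · rw [← eval_rep_mk_eq_zero_iff hg x hx0]
      refine h _ fun f hf => ?_
      rw [← sum_homogeneousComponent f, map_sum]
      refine Finset.sum_eq_zero fun i _ => ?_
      rw [eval_rep_mk_eq_zero_iff (homogeneousComponent_isHomogeneous i f)]
      exact hx _ (hhom f hf i)
  have hZs : hfin.toFinset.card = s := by
    have hM' := hM (max M (max 1 hfin.toFinset.card)) (le_max_left _ _)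
    rw [← hM', hilbertFunction_eq_card_points
      (fun t : hfin.toFinset => (t : Projectivization K (σ → K))) Subtype.val_injective _
      (by simp) J, Fintype.card_coe]
    intro f hf
    rw [hmem _ (by simp) f hf]
    simp
  let e := (hfin.toFinset.equivFinOfCardEq hZs).symm
  refine ⟨fun j => (e j : Projectivization K (σ → K)),
    Subtype.val_injective.comp e.injective, eventually_atTop.2 ⟨1, fun m hm g hg => ?_⟩⟩
  rw [hmem m hm g hg]
  refine ⟨fun h j => h _ (hfin.mem_toFinset.1 (e j).2), fun h z hz => ?_⟩
  obtain ⟨j, hj⟩ := e.surjective ⟨z, hfin.mem_toFinset.2 hz⟩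
  simpa only [hj] using h j

theorem aeval_algebraMap_comp_C_rep (f : MvPolynomial σ (PowerSeries K)) (v : σ → K) :
    aeval (fun i => algebraMap (PowerSeries K) (LaurentSeries K) (PowerSeries.C (v i))) f =
      algebraMap (PowerSeries K) (LaurentSeries K) (eval (fun i => PowerSeries.C (v i)) f) := by
  rw [← aeval_eq_eval, ← aeval_algebraMap_apply]
  rfl

/-- A set of points is its own limit. -/
theorem exists_limit_of_points {s : ℕ} (p : Fin s → Projectivization K (σ → K))
    (hp : Function.Injective p) :
    ∃ q : Fin s → Projectivization (LaurentSeries K) (σ → LaurentSeries K),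
      Function.Injective q ∧ ∀ m (g : MvPolynomial σ K), g.IsHomogeneous m →
        ((∀ j, eval (p j).rep g = 0) ↔ IsLimitForm q m g) := by
  -- The constant family: the same coordinates, regarded as Laurent series.
  let θ : K →+* LaurentSeries K := (algebraMap (PowerSeries K) (LaurentSeries K)).comp PowerSeries.C
  have hθ : Function.Injective θ := θ.injective
  have hinj : Function.Injective (algebraMap (PowerSeries K) (LaurentSeries K)) :=
    IsFractionRing.injective _ _
  have hne : ∀ j, (fun i => θ ((p j).rep i)) ≠ 0 := by
    intro j h
    apply (p j).rep_nonzero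
    ext i
    exact hθ (by simpa using congrFun h i)
  have hzero : ∀ m (f : MvPolynomial σ (PowerSeries K)), f.IsHomogeneous m → ∀ j,
      (aeval (Projectivization.mk (LaurentSeries K) _ (hne j)).rep f = 0 ↔
        eval (fun i => PowerSeries.C ((p j).rep i)) f = 0) := by
    intro m f hf j
    obtain ⟨a, ha⟩ := Projectivization.exists_smul_eq_mk_rep (LaurentSeries K) _ (hne j)
    rw [← ha, Units.smul_def, aeval_smul_of_isHomogeneous hf]
    have := aeval_algebraMap_comp_C_rep f (p j).rep
    simp only [θ, RingHom.comp_apply]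
    rw [this, mul_eq_zero, map_eq_zero_iff _ hinj]
    simp
  refine ⟨fun j => Projectivization.mk _ _ (hne j), ?_, fun m g hg => ⟨fun h => ?_, ?_⟩⟩
  · intro i j hij
    by_contra h
    obtain ⟨a, b, hab⟩ := exists_mul_rep_ne_mul_rep (hp.ne h)
    apply hab
    obtain ⟨c, hc⟩ := (Projectivization.mk_eq_mk_iff' _ _ _ (hne i) (hne j)).1 hij
    apply hθ
    have h1 := congrFun hc a
    have h2 := congrFun hc b
    simp only [Pi.smul_apply, smul_eq_mul] at h1 h2
    rw [map_mul, map_mul, ← h1, ← h2]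
    ring
  · refine ⟨MvPolynomial.map PowerSeries.C g, hg.map _, fun j => ?_, ?_⟩
    · rw [hzero m _ (hg.map _)]
      have := eval₂_comp_left (PowerSeries.C (R := K)) (RingHom.id K) (p j).rep g
      rw [eval_map]
      have h' := h j
      rw [← eval₂_id] at h'
      rw [h', map_zero] at this
      simpa [Function.comp_def] using this.symm
    · rw [MvPolynomial.map_map]
      have : (PowerSeries.constantCoeff (R := K)).comp PowerSeries.C = RingHom.id K := by
        ext; simp
      rw [this, MvPolynomial.map_id]
  · rintro ⟨f, hf, hfz, rfl⟩ j
    have h1 := (hzero m f hf j).1 (hfz j)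
    have h2 := congrArg PowerSeries.constantCoeff h1
    rw [map_zero, ← eval₂_id, eval₂_comp_left] at h2
    rw [eval_map]
    simpa [Function.comp_def] using h2

end Points

theorem homogeneousComponent_mem_ideal {k σ : Type*} [Field k] (Γ : ZeroDimSubscheme k σ) :
    ∀ f ∈ Γ.ideal, ∀ m, homogeneousComponent m f ∈ Γ.ideal :=
  fun _ hf m => homogeneousComponent_mem_of_mem Γ.homogeneous hf m

/-- Smooth zero-dimensional schemes are smoothable. -/
theorem ZeroDimSubscheme.IsSmooth.isSmoothable {k σ : Type*} [Field k] [Finite σ]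
    {Γ : ZeroDimSubscheme k σ} (h : Γ.IsSmooth) : Γ.IsSmoothable := by
  obtain ⟨p, hp, hm⟩ := exists_points_of_isRadical h
    (homogeneousComponent_mem_map (homogeneousComponent_mem_ideal Γ)) (s := Γ.degree)
    (Γ.hilbert_eventually.mono fun m hm => by
      rw [← hm]
      exact hilbertFunction_map Γ.ideal m)
  obtain ⟨q, hq, hlim⟩ := exists_limit_of_points p hp
  exact ⟨q, hq, hm.mono fun m h g hg => (h g hg).trans (hlim m g hg)⟩

/-! ### The contraction action and apolar ideals -/

section Contraction

variable {k σ : Type*} [Field k]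

theorem contraction_monomial (u : σ →₀ ℕ) (c : k) (F : MvPolynomial σ k) :
    contraction k σ (monomial u c) F = c • F.divMonomial u := by
  have h : contraction k σ (monomial u c) =
      c • monomialContraction k σ (Multiplicative.ofAdd u) :=
    AddMonoidAlgebra.lift_single _ _ _
  rw [h]
  rfl

theorem coeff_contraction (g F : MvPolynomial σ k) (v : σ →₀ ℕ) :
    coeff v (contraction k σ g F) = ∑ u ∈ g.support, coeff u g * coeff (u + v) F := by
  conv_lhs => rw [← support_sum_monomial_coeff g]
  rw [map_sum, LinearMap.sum_apply, coeff_sum]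
  refine Finset.sum_congr rfl fun u _ => ?_
  rw [contraction_monomial, coeff_smul, coeff_divMonomial, smul_eq_mul]

theorem mem_apolarIdeal {F g : MvPolynomial σ k} :
    g ∈ apolarIdeal F ↔ contraction k σ g F = 0 := Iff.rfl

theorem monomial_mem_apolarIdeal {F : MvPolynomial σ k} {u : σ →₀ ℕ} (c : k)
    (h : ∀ v, coeff (u + v) F = 0) : monomial u c ∈ apolarIdeal F := by
  rw [mem_apolarIdeal, contraction_monomial]
  ext v
  rw [coeff_smul, coeff_divMonomial, h, smul_zero, coeff_zero]

theorem map_le_apolarIdeal_map {K : Type*} [Field K] [Algebra k K] {I : Ideal (MvPolynomial σ k)}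
    {F : MvPolynomial σ k} (h : I ≤ apolarIdeal F) :
    I.map (MvPolynomial.map (algebraMap k K)) ≤
      apolarIdeal (MvPolynomial.map (algebraMap k K) F) := by
  rw [Ideal.map_le_iff_le_comap]
  intro g hg
  have hg0 : contraction k σ g F = 0 := h hg
  rw [Ideal.mem_comap, mem_apolarIdeal]
  ext v
  have := congrArg (fun f => algebraMap k K (coeff v f)) hg0
  simpa only [coeff_contraction, support_map_of_injective _ (algebraMap k K).injective, coeff_map,
    map_sum, map_mul, coeff_zero, map_zero] using this

end Contraction

/-! ### Colength bound from a regular quadric -/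

section LowerBound

variable {K σ : Type*} [Field K]

/-- A linear combination of squares of the variables is a nonzerodivisor modulo a given saturated
ideal. -/
theorem exists_quadric_regular [Finite σ] [Infinite K] {J : Ideal (MvPolynomial σ K)}
    (hJ : ∀ f, (∀ i, ∃ e : ℕ, X i ^ e * f ∈ J) → f ∈ J) :
    ∃ q : MvPolynomial σ K, q.IsHomogeneous 2 ∧ q ∈ Ideal.span (Set.range fun i => X i ^ 2) ∧
      ∀ f, q * f ∈ J → f ∈ J := by
  classical
  have := Fintype.ofFinite σ
  let L : (σ → K) →ₗ[K] MvPolynomial σ K :=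
    { toFun := fun c => ∑ i, C (c i) * X i ^ 2
      map_add' := fun c d => by simp [add_mul, Finset.sum_add_distrib]
      map_smul' := fun a c => by simp [Finset.smul_sum, smul_eq_C_mul, mul_assoc] }
  have hfin : (associatedPrimes (MvPolynomial σ K) (MvPolynomial σ K ⧸ J)).Finite :=
    associatedPrimes.finite _ (MvPolynomial σ K ⧸ J)
  let U : Ideal (MvPolynomial σ K) → Submodule K (σ → K) := fun P => (P.restrictScalars K).comap L
  -- An associated prime, the annihilator of the class of some `f`, that contains all squares
  -- contains all variables. Saturation then puts `f` in `J`, so the annihilator is the unit ideal,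
  -- which is absurd.
  have htop : ⊤ ∉ hfin.toFinset.image U := by
    intro h
    obtain ⟨P, hP, hPU⟩ := Finset.mem_image.1 h
    rw [Set.Finite.mem_toFinset, AssociatedPrimes.mem_iff, isAssociatedPrime_iff] at hP
    obtain ⟨hprime, x, rfl⟩ := hP
    obtain ⟨f, rfl⟩ := Ideal.Quotient.mk_surjective x
    apply hprime.ne_top
    have hf : f ∈ J := by
      refine hJ f fun i => ⟨1, ?_⟩
      have hi : Pi.single i 1 ∈
          U ((⊥ : Submodule (MvPolynomial σ K) (MvPolynomial σ K ⧸ J)).colon {Ideal.Quotient.mk J f}) := by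
        rw [hPU]
        trivial
      have hi2 : (X i : MvPolynomial σ K) ^ 2 ∈
          (⊥ : Submodule (MvPolynomial σ K) (MvPolynomial σ K ⧸ J)).colon {Ideal.Quotient.mk J f} := by
        have hL : L (Pi.single i 1) = X i ^ 2 := by
          simp only [L, LinearMap.coe_mk, AddHom.coe_mk]
          rw [Finset.sum_eq_single i] <;> simp +contextual
        rw [← hL]
        exact hi
      have hX := hprime.mem_of_pow_mem _ hi2
      rw [Submodule.mem_colon_singleton, Submodule.mem_bot] at hX
      rw [pow_one]
      exact Ideal.Quotient.eq_zero_iff_mem.1 hX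
    rw [Ideal.Quotient.eq_zero_iff_mem.2 hf, Submodule.colon_singleton_zero]
  -- A vector space over an infinite field is not a finite union of proper subspaces.
  obtain ⟨c, hc⟩ := (Set.ne_univ_iff_exists_notMem _).1
    (Subspace.biUnion_ne_univ_of_top_notMem htop)
  refine ⟨L c, IsHomogeneous.sum _ _ _ fun i _ => isHomogeneous_C_mul_X_pow _ _ _,
    Ideal.sum_mem _ fun i _ => Ideal.mul_mem_left _ _ (Ideal.subset_span ⟨i, rfl⟩), ?_⟩
  intro f hf
  by_contra hfJ
  have hz : L c ∈ {r : MvPolynomial σ K | ∃ x : MvPolynomial σ K ⧸ J, x ≠ 0 ∧ r • x = 0} := by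
    refine ⟨Ideal.Quotient.mk J f, fun h => hfJ (Ideal.Quotient.eq_zero_iff_mem.1 h), ?_⟩
    exact Ideal.Quotient.eq_zero_iff_mem.2 hf
  rw [← biUnion_associatedPrimes_eq_zero_divisors] at hz
  obtain ⟨P, hP, hcP⟩ := Set.mem_iUnion₂.1 hz
  apply hc
  exact Set.mem_iUnion₂.2 ⟨U P, Finset.mem_image_of_mem _ (hfin.mem_toFinset.2 hP), hcP⟩

theorem hilbertFunction_anti [Finite σ] {J A : Ideal (MvPolynomial σ K)} (h : J ≤ A) (m : ℕ) :
    hilbertFunction A m ≤ hilbertFunction J m := by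
  obtain ⟨w, hw, hli, -⟩ := exists_forms_of_hilbertFunction A m
  simpa using card_le_hilbertFunction J m w hw fun c hc => hli c (h hc)

/-- Multiplication by `q` embeds $(S/J)_m$ in $(S/J)_{d+m}$, and its image dies in $(S/A)_{d+m}$. -/
theorem hilbertFunction_add_le [Finite σ] {J A : Ideal (MvPolynomial σ K)} (h : J ≤ A)
    {q : MvPolynomial σ K} {d : ℕ} (hq : q.IsHomogeneous d) (hqA : q ∈ A)
    (hreg : ∀ f, q * f ∈ J → f ∈ J) (m : ℕ) :
    hilbertFunction J m + hilbertFunction A (d + m) ≤ hilbertFunction J (d + m) := by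
  obtain ⟨w, hw, hwli, -⟩ := exists_forms_of_hilbertFunction J m
  obtain ⟨v, hv, hvli, -⟩ := exists_forms_of_hilbertFunction A (d + m)
  have := card_le_hilbertFunction J (d + m) (Sum.elim (fun i => q * w i) v) ?_ ?_
  · simpa using this
  · rintro (i | i)
    · exact hq.mul (hw i)
    · exact hv i
  · intro c hc
    simp only [Fintype.sum_sum_type, Sum.elim_inl, Sum.elim_inr, mul_left_comm _ q,
      ← Finset.mul_sum] at hc
    have hr : ∀ i, c (Sum.inr i) = 0 :=
      hvli _ ((Ideal.add_mem_iff_right _ (Ideal.mul_mem_right _ _ hqA)).1 (h hc))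
    simp only [hr, C_0, zero_mul, Finset.sum_const_zero, add_zero] at hc
    rintro (i | i)
    · exact hwli _ (hreg _ hc) i
    · exact hr i

/-- If a saturated ideal `J` has constant Hilbert polynomial `s` and is contained in `A`, which
contains the squares of the variables, then `A` has colength at most `2 s`. -/
theorem sum_hilbertFunction_le [Finite σ] [Infinite K] {J A : Ideal (MvPolynomial σ K)}
    (hJ : ∀ f, (∀ i, ∃ e : ℕ, X i ^ e * f ∈ J) → f ∈ J) (h : J ≤ A) (hA : ∀ i, X i ^ 2 ∈ A)
    {s : ℕ} (hs : ∀ᶠ m in atTop, hilbertFunction J m = s) (N : ℕ) :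
    ∑ m ∈ Finset.range N, hilbertFunction A m ≤ 2 * s := by
  obtain ⟨q, hq, hqA, hreg⟩ := exists_quadric_regular hJ
  have hqA : q ∈ A := Ideal.span_le.2 (by rintro _ ⟨i, rfl⟩; exact hA i) hqA
  -- Since $h_A(m+2)\le h_J(m+2)-h_J(m)$, the sum telescopes in steps of two, leaving two terms; for
  -- large `M` each equals `s`.
  have key : ∀ M, ∑ m ∈ Finset.range (M + 2), hilbertFunction A m ≤
      hilbertFunction J M + hilbertFunction J (M + 1) := by
    intro M
    induction M with
    | zero =>
      rw [Finset.sum_range_succ, Finset.sum_range_one]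
      exact add_le_add (hilbertFunction_anti h 0) (hilbertFunction_anti h 1)
    | succ M ih =>
      rw [Finset.sum_range_succ]
      have := hilbertFunction_add_le h hq hqA hreg M
      rw [add_comm 2 M] at this
      have h2 : M + 1 + 1 = M + 2 := rfl
      rw [h2]
      omega
  obtain ⟨M, hM⟩ := eventually_atTop.1 hs
  calc ∑ m ∈ Finset.range N, hilbertFunction A m
      ≤ ∑ m ∈ Finset.range (max M N + 2), hilbertFunction A m :=
        Finset.sum_le_sum_of_subset (Finset.range_mono (by omega))
    _ ≤ _ := key _
    _ = 2 * s := by rw [hM _ (le_max_left _ _), hM _ (by omega), two_mul]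

end LowerBound

/-! ### Determinant and permanent -/

section PermutationForms

variable {k : Type*} [Field k] {n : ℕ}

/-- The exponent vector of the product of the entries in the columns `D` of the permutation matrix
of `π`. -/
noncomputable def permExponent (π : Equiv.Perm (Fin n)) (D : Finset (Fin n)) :
    Fin n × Fin n →₀ ℕ :=
  ∑ l ∈ D, Finsupp.single (π l, l) 1

/-- Linear combinations, with nonzero coefficients, of the `n!` monomials `∏ i, a (π i) i`,
expressed through row and column sums of exponent vectors. -/
structure IsPermutationForm (F : MvPolynomial (Fin n × Fin n) k) : Prop where
  row_sum : ∀ u, coeff u F ≠ 0 → ∀ i, ∑ j, u (i, j) = 1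
  col_sum : ∀ u, coeff u F ≠ 0 → ∀ j, ∑ i, u (i, j) = 1
  coeff_ne_zero : ∀ π, coeff (permExponent π Finset.univ) F ≠ 0

theorem permExponent_apply (π : Equiv.Perm (Fin n)) (D : Finset (Fin n)) (i j : Fin n) :
    permExponent π D (i, j) = if j ∈ D ∧ π j = i then 1 else 0 := by
  simp only [permExponent, Finsupp.finsetSum_apply, Finsupp.single_apply, Prod.mk.injEq]
  rw [ite_and]
  simp only [and_comm (b := _ = j), ite_and, Finset.sum_ite_eq']

theorem sum_permExponent_col (π : Equiv.Perm (Fin n)) (D : Finset (Fin n)) (j : Fin n) :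
    ∑ i, permExponent π D (i, j) = if j ∈ D then 1 else 0 := by
  simp [permExponent_apply, ite_and]

theorem sum_permExponent_row (π : Equiv.Perm (Fin n)) (D : Finset (Fin n)) (i : Fin n) :
    ∑ j, permExponent π D (i, j) = if i ∈ D.map π.toEmbedding then 1 else 0 := by
  simp only [permExponent_apply, ← Equiv.eq_symm_apply, and_comm (b := _ = π.symm i), ite_and,
    Finset.sum_ite_eq', Finset.mem_univ, if_true]
  simp [Finset.mem_map_equiv]

theorem degree_permExponent (π : Equiv.Perm (Fin n)) (D : Finset (Fin n)) :
    (permExponent π D).degree = D.card := by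
  simp [permExponent, map_sum]

theorem permExponent_add_compl (π : Equiv.Perm (Fin n)) (D : Finset (Fin n)) :
    permExponent π D + permExponent π Dᶜ = permExponent π Finset.univ :=
  Finset.sum_add_sum_compl D _

theorem exists_perm_map_eq {D E : Finset (Fin n)} (h : D.card = E.card) :
    ∃ π : Equiv.Perm (Fin n), D.map π.toEmbedding = E := by
  let e : D ≃ E := Finset.equivOfCardEq h
  refine ⟨e.extendSubtype, Finset.eq_of_subset_of_card_le ?_ (by simp [h])⟩
  intro x hx
  obtain ⟨y, hy, rfl⟩ := Finset.mem_map.1 hx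
  exact e.extendSubtype_mem y hy

theorem IsPermutationForm.le_one {F : MvPolynomial (Fin n × Fin n) k} (hF : IsPermutationForm F)
    (u : Fin n × Fin n →₀ ℕ) (hu : coeff u F ≠ 0) (i : Fin n × Fin n) : u i ≤ 1 := by
  rw [← hF.row_sum u hu i.1]
  exact Finset.single_le_sum (f := fun j => u (i.1, j)) (fun _ _ => Nat.zero_le _)
    (Finset.mem_univ i.2)

theorem X_sq_mem_apolarIdeal {σ : Type*} {F : MvPolynomial σ k}
    (hF : ∀ u, coeff u F ≠ 0 → ∀ i, u i ≤ 1) (i : σ) : X i ^ 2 ∈ apolarIdeal F := by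
  rw [X_pow_eq_monomial]
  refine monomial_mem_apolarIdeal _ fun v => ?_
  by_contra h
  have := hF _ h i
  simp at this
  omega

/-- For each set of `m` columns and set of `m` rows, one monomial of a partial permutation matrix is
taken. All row and column sums in `F` being 1, its complementary monomial pairs to zero with the
monomials of all other choices. -/
theorem IsPermutationForm.choose_sq_le {F : MvPolynomial (Fin n × Fin n) k}
    (hF : IsPermutationForm F) (m : ℕ) : n.choose m ^ 2 ≤ hilbertFunction (apolarIdeal F) m := by
  classical
  let P := Finset.powersetCard m (Finset.univ : Finset (Fin n))
  have hP : ∀ a : P × P, ∃ π : Equiv.Perm (Fin n),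
      (a.1 : Finset (Fin n)).map π.toEmbedding = a.2 := fun a =>
    exists_perm_map_eq (by
      rw [(Finset.mem_powersetCard.1 a.1.2).2, (Finset.mem_powersetCard.1 a.2.2).2])
  choose π hπ using hP
  have hcard : Fintype.card (P × P) = n.choose m ^ 2 := by
    rw [Fintype.card_prod, Fintype.card_coe, Finset.card_powersetCard, Finset.card_fin, sq]
  rw [← hcard]
  refine card_le_hilbertFunction _ m (fun a => monomial (permExponent (π a) a.1) 1)
    (fun a => isHomogeneous_monomial _ ?_) fun c hc a => ?_
  · rw [degree_permExponent, (Finset.mem_powersetCard.1 a.1.2).2]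
  -- The coefficient at the complementary monomial isolates `c a`.
  have h0 := congrArg (coeff (permExponent (π a) (a.1 : Finset (Fin n))ᶜ)) (mem_apolarIdeal.1 hc)
  simp only [C_mul_monomial, mul_one, map_sum, LinearMap.sum_apply, contraction_monomial,
    coeff_sum, coeff_smul, coeff_divMonomial, coeff_zero, smul_eq_mul] at h0
  rw [Finset.sum_eq_single a, permExponent_add_compl] at h0
  · exact (mul_eq_zero.1 h0).resolve_right (hF.coeff_ne_zero _)
  · intro b _ hba
    by_contra hne
    apply hba
    have hb := right_ne_zero_of_mul hne
    have hcol : (b.1 : Finset (Fin n)) = a.1 := by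
      ext j
      have := hF.col_sum _ hb j
      simp only [Finsupp.add_apply, Finset.sum_add_distrib, sum_permExponent_col,
        Finset.mem_compl] at this
      by_cases h1 : j ∈ (b.1 : Finset (Fin n)) <;> by_cases h2 : j ∈ (a.1 : Finset (Fin n)) <;>
        simp_all
    have hrow : (b.2 : Finset (Fin n)) = a.2 := by
      ext i
      have hcompl : (a.1 : Finset (Fin n))ᶜ.map (π a).toEmbedding = (a.2 : Finset (Fin n))ᶜ := by
        rw [← hπ a]
        ext x
        simp [Finset.mem_map_equiv]
      have := hF.row_sum _ hb i
      simp only [Finsupp.add_apply, Finset.sum_add_distrib, sum_permExponent_row, hπ, hcompl,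
        Finset.mem_compl] at this
      by_cases h1 : i ∈ (b.2 : Finset (Fin n)) <;> by_cases h2 : i ∈ (a.2 : Finset (Fin n)) <;>
        simp_all
    exact Prod.ext (Subtype.ext hcol) (Subtype.ext hrow)
  · simp

theorem IsPermutationForm.map {K : Type*} [Field K] [Algebra k K]
    {F : MvPolynomial (Fin n × Fin n) k} (hF : IsPermutationForm F) :
    IsPermutationForm (MvPolynomial.map (algebraMap k K) F) where
  row_sum u hu := hF.row_sum u fun h => hu (by rw [coeff_map, h, map_zero])
  col_sum u hu := hF.col_sum u fun h => hu (by rw [coeff_map, h, map_zero])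
  coeff_ne_zero π := by
    rw [coeff_map]
    exact (map_ne_zero _).2 (hF.coeff_ne_zero π)

/-- Distinct permutations have distinct exponent vectors, so nothing cancels. -/
theorem isPermutationForm_sum (c : Equiv.Perm (Fin n) → k) (hc : ∀ π, c π ≠ 0) :
    IsPermutationForm (∑ π, monomial (permExponent π Finset.univ) (c π)) := by
  classical
  have hsupp : ∀ u, coeff u (∑ π, monomial (permExponent π Finset.univ) (c π)) ≠ 0 →
      ∃ π : Equiv.Perm (Fin n), permExponent π Finset.univ = u := by
    intro u hu
    rw [coeff_sum] at hu
    obtain ⟨π, -, hπ⟩ := Finset.exists_ne_zero_of_sum_ne_zero hu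
    rw [coeff_monomial] at hπ
    exact ⟨π, by_contra fun h => hπ (if_neg h)⟩
  refine ⟨fun u hu i => ?_, fun u hu j => ?_, fun π => ?_⟩
  · obtain ⟨π, rfl⟩ := hsupp u hu
    simp [sum_permExponent_row]
  · obtain ⟨π, rfl⟩ := hsupp u hu
    simp [sum_permExponent_col]
  · rw [coeff_sum, Finset.sum_eq_single π]
    · simpa using hc π
    · intro τ _ hτ
      rw [coeff_monomial, if_neg]
      intro h
      apply hτ
      ext1 j
      have := DFunLike.congr_fun h (τ j, j)
      by_contra hne
      simp [permExponent_apply, Ne.symm hne] at this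
    · simp

theorem prod_X_eq_monomial (π : Equiv.Perm (Fin n)) :
    ∏ j, (X (π j, j) : MvPolynomial (Fin n × Fin n) k) =
      monomial (permExponent π Finset.univ) 1 := by
  rw [permExponent, monomial_sum_one]
  rfl

theorem isPermutationForm_det :
    IsPermutationForm (Matrix.mvPolynomialX (Fin n) (Fin n) k).det := by
  have h : (Matrix.mvPolynomialX (Fin n) (Fin n) k).det =
      ∑ π, monomial (permExponent π Finset.univ) (((Equiv.Perm.sign π : ℤ) : k)) := by
    rw [Matrix.det_apply']
    refine Finset.sum_congr rfl fun π _ => ?_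
    simp only [Matrix.mvPolynomialX_apply, prod_X_eq_monomial]
    rw [← map_intCast (C : k →+* _), C_mul_monomial, mul_one]
  rw [h]
  refine isPermutationForm_sum _ fun π => ?_
  rcases Int.units_eq_one_or (Equiv.Perm.sign π) with h | h <;> simp [h]

theorem isPermutationForm_permanent :
    IsPermutationForm (Matrix.mvPolynomialX (Fin n) (Fin n) k).permanent := by
  have h : (Matrix.mvPolynomialX (Fin n) (Fin n) k).permanent =
      ∑ π, monomial (permExponent π Finset.univ) 1 := by
    rw [Matrix.permanent]
    refine Finset.sum_congr rfl fun π _ => ?_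
    simp only [Matrix.mvPolynomialX_apply, prod_X_eq_monomial]
  rw [h]
  exact isPermutationForm_sum _ fun π => one_ne_zero

theorem IsPermutationForm.choose_le_two_mul_degree {F : MvPolynomial (Fin n × Fin n) k}
    (hF : IsPermutationForm F) {Γ : ZeroDimSubscheme k (Fin n × Fin n)} (hΓ : Γ.IsApolar F) :
    (2 * n).choose n ≤ 2 * Γ.degree := by
  let K := AlgebraicClosure k
  have hFK : IsPermutationForm (MvPolynomial.map (algebraMap k K) F) := hF.map
  rw [← Nat.sum_range_choose_sq]
  refine (Finset.sum_le_sum fun m _ => hFK.choose_sq_le m).trans ?_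
  refine sum_hilbertFunction_le (J := Γ.ideal.map (MvPolynomial.map (algebraMap k K)))
    (mem_map_of_X_pow_mul_mem Γ.saturated) (map_le_apolarIdeal_map hΓ)
    (X_sq_mem_apolarIdeal hFK.le_one) ?_ _
  exact Γ.hilbert_eventually.mono fun m hm => by rw [hilbertFunction_map, hm]

end PermutationForms

/-! ### Polarization with sign vectors -/

section SignVectors

variable {k σ : Type*} [Field k]

/-- The vector supported on `T` with entries `-1` on `A` and `1` on the rest of `T`. -/
def signVector (k : Type*) [Field k] [DecidableEq σ] (T A : Finset σ) (i : σ) : k :=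
  if i ∈ T then if i ∈ A then -1 else 1 else 0

/-- The sum factors as $c\prod_{i\notin T}0^{v_i}\prod_{i\in T}(1-(-1)^{v_i})$. It vanishes unless
`v` is supported in `T` with odd entries on `T`; the degree then forces these entries to be 1. -/
theorem sum_sign_mul_eval_monomial [Fintype σ] [DecidableEq σ] (T : Finset σ) (v : σ →₀ ℕ)
    (hv : v.degree = T.card) (c : k) :
    ∑ A ∈ T.powerset, (-1) ^ A.card * eval (signVector k T A) (monomial v c) =
      2 ^ T.card * coeff (∑ i ∈ T, Finsupp.single i 1) (monomial v c) := by
  have hind : ∀ j, (∑ i ∈ T, Finsupp.single i 1 : σ →₀ ℕ) j = if j ∈ T then 1 else 0 := by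
    intro j
    simp [Finsupp.finsetSum_apply, Finsupp.single_apply]
  have heval : ∀ A ∈ T.powerset, (-1) ^ A.card * eval (signVector k T A) (monomial v c) =
      c * (∏ i ∈ Tᶜ, 0 ^ v i) * ((∏ i ∈ A, -(-1 : k) ^ v i) * ∏ i ∈ T \ A, 1) := by
    intro A hA
    rw [Finset.mem_powerset] at hA
    rw [eval_monomial, Finsupp.prod_fintype _ _ (by simp), ← Finset.prod_compl_mul_prod T,
      ← Finset.prod_sdiff hA]
    have h1 : ∏ i ∈ Tᶜ, signVector k T A i ^ v i = ∏ i ∈ Tᶜ, 0 ^ v i :=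
      Finset.prod_congr rfl fun i hi => by
        rw [signVector, if_neg (Finset.mem_compl.1 hi)]
    have h2 : ∏ i ∈ T \ A, signVector k T A i ^ v i = ∏ i ∈ T \ A, 1 :=
      Finset.prod_congr rfl fun i hi => by
        rw [Finset.mem_sdiff] at hi
        rw [signVector, if_pos hi.1, if_neg hi.2, one_pow]
    have h3 : ∏ i ∈ A, signVector k T A i ^ v i = ∏ i ∈ A, (-1) ^ v i :=
      Finset.prod_congr rfl fun i hi => by
        rw [signVector, if_pos (hA hi), if_pos hi]
    have h4 : ∏ i ∈ A, -(-1 : k) ^ v i = (-1) ^ A.card * ∏ i ∈ A, (-1) ^ v i := by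
      rw [← Finset.prod_const, ← Finset.prod_mul_distrib]
      simp
    rw [h1, h2, h3, h4]
    ring
  rw [Finset.sum_congr rfl heval, ← Finset.mul_sum, ← Finset.prod_add, coeff_monomial]
  split_ifs with h
  · have h1 : ∏ i ∈ Tᶜ, (0 : k) ^ v i = 1 := Finset.prod_eq_one fun i hi => by
      rw [h, hind, if_neg (Finset.mem_compl.1 hi), pow_zero]
    have h2 : ∏ i ∈ T, (-(-1 : k) ^ v i + 1) = 2 ^ T.card := by
      rw [← Finset.prod_const]
      refine Finset.prod_congr rfl fun i hi => ?_
      rw [h, hind, if_pos hi]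
      norm_num
    rw [h1, h2]
    ring
  · rw [mul_zero]
    by_cases hT : ∃ i ∈ Tᶜ, v i ≠ 0
    · obtain ⟨i, hi, hvi⟩ := hT
      rw [Finset.prod_eq_zero hi (zero_pow hvi), mul_zero, zero_mul]
    · push Not at hT
      have heven : ∃ i ∈ T, Even (v i) := by
        by_contra! hodd
        apply h
        have hpos : ∀ i ∈ T, 1 ≤ v i := fun i hi => by
          by_contra h0
          have := hodd i hi
          simp [show v i = 0 by omega] at this
        have hsum : ∑ i ∈ T, 1 = ∑ i ∈ T, v i := by
          rw [Finset.sum_const, smul_eq_mul, mul_one, ← hv, Finsupp.degree_eq_sum,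
            ← Finset.sum_compl_add_sum T, Finset.sum_eq_zero hT, zero_add]
        have heq := (Finset.sum_eq_sum_iff_of_le hpos).1 hsum
        ext j
        rw [hind]
        split_ifs with hj
        · exact (heq j hj).symm
        · exact hT j (Finset.mem_compl.2 hj)
      obtain ⟨i, hi, hev⟩ := heven
      rw [Finset.prod_eq_zero hi (by rw [hev.neg_one_pow]; ring), mul_zero]

/-- Polarization: squarefree coefficients of a form are determined by its values on vectors with
entries `0` and `±1`. -/
theorem sum_sign_mul_eval [Fintype σ] [DecidableEq σ] (T : Finset σ) {h : MvPolynomial σ k}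
    (hh : h.IsHomogeneous T.card) :
    ∑ A ∈ T.powerset, (-1) ^ A.card * eval (signVector k T A) h =
      2 ^ T.card * coeff (∑ i ∈ T, Finsupp.single i 1) h := by
  rw [← support_sum_monomial_coeff h, coeff_sum, Finset.mul_sum]
  simp only [map_sum, Finset.mul_sum]
  rw [Finset.sum_comm]
  refine Finset.sum_congr rfl fun v hv => ?_
  refine sum_sign_mul_eval_monomial T v ?_ _
  by_contra hne
  exact (mem_support_iff.1 hv) (hh.coeff_eq_zero hne)

end SignVectors

/-! ### A smooth apolar scheme -/

section PointSchemes

variable {k σ : Type*} [Field k]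

theorem mem_pointsIdeal_of_X_pow_mul_mem {ι : Type*} {p : ι → Projectivization k (σ → k)}
    (f : MvPolynomial σ k) (hf : ∀ i, ∃ e : ℕ, X i ^ e * f ∈ pointsIdeal p) :
    f ∈ pointsIdeal p := by
  rw [pointsIdeal, Ideal.mem_iInf]
  intro j
  obtain ⟨i, hi⟩ := Function.ne_iff.1 (p j).rep_nonzero
  obtain ⟨e, he⟩ := hf i
  rw [pointsIdeal, Ideal.mem_iInf] at he
  have := he j
  rw [RingHom.mem_ker, map_mul, map_pow, aeval_X] at this
  rw [RingHom.mem_ker]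
  refine (mul_eq_zero.1 this).resolve_left (pow_ne_zero _ (mul_ne_zero ?_ Polynomial.X_ne_zero))
  exact Polynomial.C_ne_zero.2 hi

/-- The extended ideal is the ideal of the same points over `K`, because functionals commute with
evaluation at `k`-rational vectors. -/
theorem map_pointsIdeal_isRadical {K : Type*} [Field K] [Algebra k K] {ι : Type*}
    (p : ι → Projectivization k (σ → k)) :
    ((pointsIdeal p).map (MvPolynomial.map (algebraMap k K))).IsRadical := by
  have hne : ∀ j, (fun i => algebraMap k K ((p j).rep i)) ≠ 0 := by
    intro j h
    apply (p j).rep_nonzero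
    ext i
    exact (algebraMap k K).injective (by simpa using congrFun h i)
  have : (pointsIdeal p).map (MvPolynomial.map (algebraMap k K)) =
      pointsIdeal fun j => Projectivization.mk K _ (hne j) := by
    ext f
    rw [mem_map_iff_coeffwise_mem, mem_pointsIdeal]
    simp only [mem_pointsIdeal, ← coeffwise_homogeneousComponent, eval_coeffwise,
      eval_rep_mk_eq_zero_iff (homogeneousComponent_isHomogeneous _ f)]
    exact ⟨fun h j m => (Module.forall_dual_apply_eq_zero_iff k _).1 fun φ => h φ j m,
      fun h φ j m => by rw [h, map_zero]⟩
  rw [this]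
  exact pointsIdeal_isRadical _

/-- The reduced subscheme whose support is a finite set of rational points. -/
noncomputable def pointsSubscheme {ι : Type*} [Fintype ι] [Nonempty ι]
    (p : ι → Projectivization k (σ → k)) (hp : Function.Injective p) : ZeroDimSubscheme k σ where
  ideal := pointsIdeal p
  homogeneous := by
    intro m f hf
    have h := decomposition.decompose'_apply f m
    exact h ▸ homogeneousComponent_mem_pointsIdeal hf m
  saturated := mem_pointsIdeal_of_X_pow_mul_mem
  degree := Fintype.card ι
  degree_pos := Fintype.card_pos
  hilbert_eventually := eventually_atTop.2 ⟨Fintype.card ι, fun m hm =>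
    hilbertFunction_eq_card_points p hp m hm _ fun _ hf => mem_pointsIdeal_of_isHomogeneous hf⟩

theorem pointsSubscheme_isSmooth {ι : Type*} [Fintype ι] [Nonempty ι]
    (p : ι → Projectivization k (σ → k)) (hp : Function.Injective p) :
    (pointsSubscheme p hp).IsSmooth :=
  map_pointsIdeal_isRadical p

/-- A squarefree form has a smooth apolar scheme, consisting of the points with coordinates
`0` and `±1`. -/
theorem exists_isSmooth_isApolar [Finite σ] [Nonempty σ] (hk : ringChar k ≠ 2)
    {F : MvPolynomial σ k} (hF : ∀ u, coeff u F ≠ 0 → ∀ i, u i ≤ 1) :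
    ∃ Γ : ZeroDimSubscheme k σ, Γ.IsSmooth ∧ Γ.IsApolar F := by
  classical
  have := Fintype.ofFinite σ
  let V : Finset (σ → k) := (Fintype.piFinset fun _ => {0, 1, -1}).erase 0
  have hV : ∀ v ∈ V, v ≠ 0 := fun v hv => (Finset.mem_erase.1 hv).1
  let P : V → Projectivization k (σ → k) := fun v => Projectivization.mk k v.1 (hV v.1 v.2)
  have : Nonempty V := ⟨fun _ => 1, Finset.mem_erase.2 ⟨fun h => by
    simpa using congrFun h (Classical.arbitrary σ), by simp⟩⟩
  -- Opposite vectors give the same point, so the points are indexed by the range of `P`.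
  have : Fintype (Set.range P) := Fintype.ofFinite _
  refine ⟨pointsSubscheme (Subtype.val : Set.range P → _) Subtype.val_injective,
    pointsSubscheme_isSmooth _ _, fun g hg => ?_⟩
  have hg : ∀ m, ∀ v ∈ V, eval v (homogeneousComponent m g) = 0 := fun m v hv =>
    (eval_rep_mk_eq_zero_iff (homogeneousComponent_isHomogeneous m g) v (hV v hv)).1
      (mem_pointsIdeal.1 hg ⟨P ⟨v, hv⟩, ⟨v, hv⟩, rfl⟩ m)
  have hg' : ∀ m (T A : Finset σ), eval (signVector k T A) (homogeneousComponent m g) = 0 := by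
    intro m T A
    -- The zero vector is not a projective point; writing it as $0\cdot v$ with `v` in `V` covers
    -- degree 0 as well.
    by_cases h0 : signVector k T A = 0
    · obtain ⟨v, hv⟩ := Classical.arbitrary V
      rw [h0, ← zero_smul k v, eval_smul_of_isHomogeneous (homogeneousComponent_isHomogeneous m g),
        hg m v hv, mul_zero]
    · refine hg m _ (Finset.mem_erase.2 ⟨h0, ?_⟩)
      rw [Fintype.mem_piFinset]
      intro i
      unfold signVector
      split_ifs <;> simp
  have h2 : (2 : k) ≠ 0 := Ring.two_ne_zero hk
  have hcoeff : ∀ u : σ →₀ ℕ, (∀ i, u i ≤ 1) → coeff u g = 0 := by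
    intro u hu
    have hu' : u = ∑ i ∈ u.support, Finsupp.single i 1 := by
      ext j
      have := hu j
      rw [Finsupp.finsetSum_apply]
      simp only [Finsupp.single_apply, Finset.sum_ite_eq', Finsupp.mem_support_iff]
      split_ifs <;> omega
    have hdeg : u.degree = u.support.card := by
      conv_lhs => rw [hu']
      simp [map_sum]
    have h := sum_sign_mul_eval u.support
      (homogeneousComponent_isHomogeneous u.support.card g)
    rw [Finset.sum_eq_zero fun A _ => by rw [hg', mul_zero], ← hu', coeff_homogeneousComponent,
      if_pos hdeg] at h
    exact (mul_eq_zero.1 h.symm).resolve_left (pow_ne_zero _ h2)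
  rw [mem_apolarIdeal]
  ext v
  rw [coeff_contraction, coeff_zero]
  -- If `u + v` occurs in `F`, then `u` is squarefree, and `g` has no such coefficient.
  refine Finset.sum_eq_zero fun u _ => ?_
  by_cases h : coeff (u + v) F = 0
  · rw [h, mul_zero]
  · rw [hcoeff u fun i => ?_, zero_mul]
    exact le_trans (by simp) (hF _ h i)

end PointSchemes

end Apolarity

/-! ### Comparison of the three ranks -/

theorem theorem3 {k : Type*} [Field k] (hk : ringChar k ≠ 2) (n : ℕ) (hn : 1 ≤ n)
    (F : MvPolynomial (Fin n × Fin n) k)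
    (hF : F = (Matrix.mvPolynomialX (Fin n) (Fin n) k).det ∨
      F = (Matrix.mvPolynomialX (Fin n) (Fin n) k).permanent) :
    (1 / 2 : ℝ) * ((2 * n).choose n : ℝ) ≤ (Apolarity.cactusRank F : ℝ) ∧
      Apolarity.cactusRank F ≤ Apolarity.smoothableRank F ∧
      Apolarity.smoothableRank F ≤ Apolarity.rank F := by
  have : Nonempty (Fin n × Fin n) := ⟨⟨0, hn⟩, ⟨0, hn⟩⟩
  have hF' : Apolarity.IsPermutationForm F := by
    rcases hF with rfl | rfl
    · exact Apolarity.isPermutationForm_det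
    · exact Apolarity.isPermutationForm_permanent
  -- This scheme makes all three sets of degrees nonempty, so each infimum is attained rather than
  -- being the default value 0.
  obtain ⟨Γ, hsm, hap⟩ := Apolarity.exists_isSmooth_isApolar hk hF'.le_one
  refine ⟨?_, ?_, ?_⟩
  · obtain ⟨Δ, hΔ, hdeg⟩ : Apolarity.cactusRank F ∈ _ := Nat.sInf_mem ⟨Γ.degree, Γ, hap, rfl⟩
    have h : (((2 * n).choose n : ℕ) : ℝ) ≤ ((2 * Δ.degree : ℕ) : ℝ) :=
      Nat.cast_le.2 (hF'.choose_le_two_mul_degree hΔ)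
    rw [← hdeg]
    push_cast at h
    linarith
  · obtain ⟨Δ, -, hΔ, hdeg⟩ : Apolarity.smoothableRank F ∈ _ :=
      Nat.sInf_mem ⟨Γ.degree, Γ, hsm.isSmoothable, hap, rfl⟩
    exact Nat.sInf_le ⟨Δ, hΔ, hdeg⟩
  · obtain ⟨Δ, hΔs, hΔ, hdeg⟩ : Apolarity.rank F ∈ _ := Nat.sInf_mem ⟨Γ.degree, Γ, hsm, hap, rfl⟩
    exact Nat.sInf_le ⟨Δ, hΔs.isSmoothable, hΔ, hdeg⟩
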